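/- Write $\Delta^{m-1}=\{p\in\mathbb{R}^m: p_i\ge 0,\ \sum_i p_i=1\}$. For $A\in\mathbb{R}^{n\times d}$, the two-sided oracle $\mathcal{O}_2^A$ answers a query $(p,w)\in\mathbb{R}^n\times\mathbb{R}^d$ with the pair $(p^\top A, Aw)$. A deterministic algorithm making $T$ queries chooses each query $(p_t,w_t)$, $t=1,\dots,T$, and its final output, as arbitrary functions of the oracle responses received before (the functions may depend on $n,d,T$). (i) There is a universal constant $c>0$ such that the following holds. Let $T,n,d$ be natural numbers with $T>c$, $d>cT$ and $n>cT^2\log T$. For every deterministic algorithm making $T$ two-sided oracle queries and returning a vector $w_{T+1}\in\mathbb{R}^d$, there is a matrix $A\in[-1,1]^{n\times d}$ with $$\max_{w\in\mathbb{R}^d:\,\|w\|_1\le 1}\ \min_{p\in\Delta^{n-1}}p^\top Aw\ \ge\ \frac{1}{c\,\log(d)\sqrt{\log n}}\cdot\frac{1}{T^{2}\sqrt{T}},$$ and yet the output of the algorithm, run with the oracle $\mathcal{O}_2^A$, satisfies $\min_{p\in\Delta^{n-1}}p^\top Aw_{T+1}\le 0$. (ii) Consequently, there is a universal constant $C>0$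 such that the following holds. Let $T\ge 1$, $n$, $d$ be natural numbers and $\varepsilon>0$, with $d>CT$, $n>CT^2\log(T+1)$ and $$T\ \le\ \frac1C\,(\log d)^{-2/5}(\log n)^{-1/5}\,\varepsilon^{-2/5}.$$ Then for every deterministic algorithm making $T$ two-sided oracle queries and returning a vector $\hat w$, there is $A\in[-1,1]^{n\times d}$ for which $\hat w$ is not an $\varepsilon$-suboptimal strategy of the simplex/simplex game, that is, it is not true that $\hat w\in\Delta^{d-1}$ and $\max_{w\in\Delta^{d-1}}\min_{p\in\Delta^{n-1}}p^\top Aw-\min_{p\in\Delta^{n-1}}p^\top A\hat w\le\varepsilon$. Likewise, for every such algorithm returning a pair $(\hat p,\hat w)$, there is $A\in[-1,1]^{n\times d}$ for which $(\hat p,\hat w)$ is not an $\varepsilon$-approximate Nash equilibrium, that is, it is not true that $\hat p\in\Delta^{n-1}$, $\hat w\in\Delta^{d-1}$ and $\max_{w\in\Delta^{d-1}}\hat p^\top Aw-\min_{p\in\Delta^{n-1}}p^\top A\hat w\le\varepsilon$. -/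

import Mathlib

open Matrix

/-- The response of the two-sided oracle: the pair `(pᵀ A, A w)`. -/
abbrev OracleResponse (n d : ℕ) : Type := (Fin d → ℝ) × (Fin n → ℝ)

/-- The two-sided oracle of the matrix `A`: on a query `(p, w)`, with no restriction on `p` and `w`,
it returns `(pᵀ A, A w)`. -/
def twoSidedOracle {n d : ℕ} (A : Matrix (Fin n) (Fin d) ℝ)
    (q : (Fin n → ℝ) × (Fin d → ℝ)) : OracleResponse n d :=
  (q.1 ᵥ* A, A *ᵥ q.2)

/-- A deterministic algorithm interacting with a two-sided oracle: every query `(p, w)`, and the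
final output (of type `Out`), is a function of the list of the oracle responses received so far
(in chronological order). -/
structure TwoSidedAlgorithm (n d : ℕ) (Out : Type) where
  query : List (OracleResponse n d) → (Fin n → ℝ) × (Fin d → ℝ)
  output : List (OracleResponse n d) → Out

namespace TwoSidedAlgorithm

variable {n d : ℕ} {Out : Type}

/-- The oracle responses received in the first `t` rounds of interaction with the oracle of `A`. -/
def transcript (alg : TwoSidedAlgorithm n d Out) (A : Matrix (Fin n) (Fin d) ℝ) :
    ℕ → List (OracleResponse n d)
  | 0 => []
  | t + 1 => alg.transcript A t ++ [twoSidedOracle A (alg.query (alg.transcript A t))]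

/-- The output of the algorithm after `T` rounds of interaction with the oracle of `A`. -/
def run (alg : TwoSidedAlgorithm n d Out) (A : Matrix (Fin n) (Fin d) ℝ) (T : ℕ) : Out :=
  alg.output (alg.transcript A T)

end TwoSidedAlgorithm

/-- The closed unit ball of the `ℓ₁` norm in `ℝ^d`. -/
def l1Ball (d : ℕ) : Set (Fin d → ℝ) := {w | ∑ i, |w i| ≤ 1}

/-- `v = min_{p ∈ Δ} pᵀ A w`, the minimum being attained. -/
def IsMinValue {n d : ℕ} (A : Matrix (Fin n) (Fin d) ℝ) (w : Fin d → ℝ) (v : ℝ) : Prop :=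
  IsLeast ((fun p : Fin n → ℝ => p ⬝ᵥ (A *ᵥ w)) '' stdSimplex ℝ (Fin n)) v

/-- `γ = max_{w ∈ W} min_{p ∈ Δ} pᵀ A w`, the maximum and the minima being attained. -/
def IsGameValue {n d : ℕ} (W : Set (Fin d → ℝ)) (A : Matrix (Fin n) (Fin d) ℝ) (γ : ℝ) : Prop :=
  IsGreatest {v : ℝ | ∃ w ∈ W, IsMinValue A w v} γ

/-- `w` is an `ε`-suboptimal strategy of the game `max_{w ∈ W} min_{p ∈ Δ} pᵀ A w`. -/
def IsSuboptimalStrategy {n d : ℕ} (W : Set (Fin d → ℝ)) (A : Matrix (Fin n) (Fin d) ℝ) (ε : ℝ)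
    (w : Fin d → ℝ) : Prop :=
  w ∈ W ∧ ∀ γ v : ℝ, IsGameValue W A γ → IsMinValue A w v → γ - v ≤ ε

/-- `(p₀, w₀)` is an `ε`-approximate Nash equilibrium (saddle point) of the simplex/simplex game:
both are mixed strategies and `max_{w ∈ Δ} p₀ᵀ A w - min_{p ∈ Δ} pᵀ A w₀ ≤ ε`. -/
def IsApproxNash {n d : ℕ} (A : Matrix (Fin n) (Fin d) ℝ) (ε : ℝ)
    (s : (Fin n → ℝ) × (Fin d → ℝ)) : Prop :=
  s.1 ∈ stdSimplex ℝ (Fin n) ∧ s.2 ∈ stdSimplex ℝ (Fin d) ∧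
    ∀ p ∈ stdSimplex ℝ (Fin n), ∀ w ∈ stdSimplex ℝ (Fin d),
      s.1 ⬝ᵥ (A *ᵥ w) - p ⬝ᵥ (A *ᵥ s.2) ≤ ε

/-! An adversary builds `A` as the algorithm runs. Rows are split into `T + 1` groups, and `A` is a
multiple of `1 u₀ᵀ` plus corrections proportional to `bₛ (uₛ - uₛ₊₁)ᵀ`, with `bₛ` supported on group
`s`. Correction `s` is fixed once query `s` is known and is orthogonal, on both sides, to all
earlier queries, so it alters no earlier response (`twoSidedOracle_add_vecMulVec`). Dimension
counting always leaves room for it (`exists_isResisting`).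

The output `w` counts as one more query, so the last `u` is orthogonal to it. The increments `uₛ ⬝ᵥ
w - uₛ₊₁ ⬝ᵥ w` then sum to `u₀ ⬝ᵥ w`; one of them is at least the average, and in its group a row
with `bₛ = -1` has payoff at most `0`. Yet a mixed strategy with the same positive inner product
with every `uₛ` kills all corrections and earns the same positive amount on every row
(`exists_mem_stdSimplex_dotProduct_eq`).

The construction needs only `n ≥ (T + 1)²` and `d ≥ 2T + 4`; the logarithms in the theorem are
slack. -/

/-! ### Perturbations invisible to the oracle -/

open Finset in
/-- Fewer linear constraints than available coordinates leave room for a nonzero vector. -/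
lemma exists_normalized_orthogonal {ι κ : Type*} [Fintype ι] [DecidableEq ι] [Fintype κ]
    (c : κ → ι → ℝ) (S : Finset ι) (h : Fintype.card κ < #S) :
    ∃ b : ι → ℝ, (∀ i ∉ S, b i = 0) ∧ (∀ k, c k ⬝ᵥ b = 0) ∧ (∀ i, |b i| ≤ 1) ∧
      ∃ i ∈ S, b i = -1 := by
  let M : Matrix (κ ⊕ {i // i ∉ S}) ι ℝ :=
    Matrix.of (Sum.elim c (fun i => Pi.single i.1 1))
  have hker : LinearMap.ker M.mulVecLin ≠ ⊥ := by
    apply LinearMap.ker_ne_bot_of_finrank_lt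
    have h1 : Fintype.card {i // i ∉ S} = Fintype.card ι - #S := by
      rw [Fintype.card_subtype_compl, Fintype.card_coe]
    have h2 : #S ≤ Fintype.card ι := Finset.card_le_univ S
    simp only [Module.finrank_fintype_fun_eq_card, Fintype.card_sum, h1]
    omega
  obtain ⟨x, hx, hx0⟩ := (Submodule.ne_bot_iff _).1 hker
  have hMx : M *ᵥ x = 0 := by simpa using hx
  obtain ⟨i₁, hi₁⟩ := Function.ne_iff.1 hx0
  obtain ⟨i₀, -, hi₀⟩ := exists_max_image univ (fun i => |x i|) ⟨i₁, mem_univ _⟩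
  have hpos : 0 < |x i₀| := (abs_pos.2 hi₁).trans_le (hi₀ i₁ (mem_univ _))
  have hne : x i₀ ≠ 0 := abs_pos.1 hpos
  have hS : ∀ i ∉ S, x i = 0 := fun i hi => by
    have := congrFun hMx (Sum.inr ⟨i, hi⟩)
    simpa [M, Matrix.mulVec] using this
  have hc : ∀ k, c k ⬝ᵥ x = 0 := fun k => by
    have := congrFun hMx (Sum.inl k)
    simpa [M, Matrix.mulVec] using this
  -- Dividing by minus the entry of largest modulus bounds all entries by `1` and turns that entry
  -- into `-1`.
  refine ⟨(-(x i₀)⁻¹) • x, fun i hi => by simp [hS i hi], fun k => ?_, fun i => ?_, i₀, ?_, ?_⟩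
  · rw [dotProduct_smul, hc, smul_zero]
  · rw [Pi.smul_apply, smul_eq_mul, abs_mul, abs_neg, abs_inv, inv_mul_le_iff₀ hpos, mul_one]
    exact hi₀ i (mem_univ _)
  · by_contra hi
    exact hne (hS _ hi)
  · simp [hne]

/-- A rank-one perturbation orthogonal to both queries is invisible to the oracle. -/
lemma twoSidedOracle_add_vecMulVec {n d : ℕ} (A : Matrix (Fin n) (Fin d) ℝ) (x : Fin n → ℝ)
    (z : Fin d → ℝ) (q : (Fin n → ℝ) × (Fin d → ℝ)) (hx : q.1 ⬝ᵥ x = 0) (hz : z ⬝ᵥ q.2 = 0) :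
    twoSidedOracle (A + vecMulVec x z) q = twoSidedOracle A q := by
  simp [twoSidedOracle, Matrix.vecMul_add, Matrix.add_mulVec, Matrix.vecMul_vecMulVec,
    Matrix.vecMulVec_mulVec, hx, hz]

namespace TwoSidedAlgorithm

variable {n d : ℕ} {Out : Type}

lemma transcript_congr (alg : TwoSidedAlgorithm n d Out) (A A' : Matrix (Fin n) (Fin d) ℝ) (t : ℕ)
    (h : ∀ s < t, twoSidedOracle A' (alg.query (alg.transcript A s)) =
      twoSidedOracle A (alg.query (alg.transcript A s))) :
    alg.transcript A' t = alg.transcript A t := by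
  induction t with
  | zero => rfl
  | succ t ih =>
    have := ih fun s hs => h s (by omega)
    rw [transcript, transcript, this, h t (by omega)]

end TwoSidedAlgorithm

/-! ### The resisting adversary -/

/-- The matrix `σ (1 u₀ᵀ + K ∑_{s < k} bₛ (uₛ - uₛ₊₁)ᵀ)`. -/
def telescopingMatrix {n d : ℕ} (σ K : ℝ) (b : ℕ → Fin n → ℝ) (u : ℕ → Fin d → ℝ) (k : ℕ) :
    Matrix (Fin n) (Fin d) ℝ :=
  vecMulVec (fun _ => σ) (u 0) + ∑ s ∈ Finset.range k, vecMulVec ((σ * K) • b s) (u s - u (s + 1))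

lemma telescopingMatrix_succ {n d : ℕ} (σ K : ℝ) (b : ℕ → Fin n → ℝ) (u : ℕ → Fin d → ℝ) (k : ℕ) :
    telescopingMatrix σ K b u (k + 1) =
      telescopingMatrix σ K b u k + vecMulVec ((σ * K) • b k) (u k - u (k + 1)) := by
  rw [telescopingMatrix, telescopingMatrix, Finset.sum_range_succ, add_assoc]

lemma telescopingMatrix_congr {n d : ℕ} (σ K : ℝ) {b b' : ℕ → Fin n → ℝ} {u u' : ℕ → Fin d → ℝ}
    {k : ℕ} (hb : ∀ s < k, b s = b' s) (hu : ∀ s ≤ k, u s = u' s) :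
    telescopingMatrix σ K b u k = telescopingMatrix σ K b' u' k := by
  rw [telescopingMatrix, telescopingMatrix, hu 0 (by omega)]
  congr 1
  refine Finset.sum_congr rfl fun s hs => ?_
  have := Finset.mem_range.1 hs
  rw [hb s this, hu s (by omega), hu (s + 1) (by omega)]

lemma telescopingMatrix_mulVec {n d : ℕ} (σ K : ℝ) (b : ℕ → Fin n → ℝ) (u : ℕ → Fin d → ℝ) (k : ℕ)
    (w : Fin d → ℝ) (i : Fin n) :
    (telescopingMatrix σ K b u k *ᵥ w) i =
      σ * (u 0 ⬝ᵥ w + K * ∑ s ∈ Finset.range k, b s i * (u s ⬝ᵥ w - u (s + 1) ⬝ᵥ w)) := by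
  induction k with
  | zero => simp [telescopingMatrix, Matrix.vecMulVec_mulVec]
  | succ k ih =>
    rw [telescopingMatrix_succ, Matrix.add_mulVec, Pi.add_apply, ih, Finset.sum_range_succ,
      Matrix.vecMulVec_mulVec]
    simp [sub_dotProduct]
    ring

lemma telescopingMatrix_apply {n d : ℕ} (σ K : ℝ) (b : ℕ → Fin n → ℝ) (u : ℕ → Fin d → ℝ) (k : ℕ)
    (i : Fin n) (j : Fin d) :
    telescopingMatrix σ K b u k i j =
      σ * (u 0 j + K * ∑ s ∈ Finset.range k, b s i * (u s j - u (s + 1) j)) := by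
  have := telescopingMatrix_mulVec σ K b u k (Pi.single j 1) i
  simpa using this

/-- The invariants kept by the adversary after `k` rounds: the rows are perturbed in the groups
`G 0, …, G (k - 1)`, and `q t` is the query of round `t`. -/
structure IsResisting {n d : ℕ} (G : ℕ → Finset (Fin n)) (S : Finset (Fin d)) (k : ℕ)
    (b : ℕ → Fin n → ℝ) (u : ℕ → Fin d → ℝ) (q : ℕ → (Fin n → ℝ) × (Fin d → ℝ)) : Prop where
  b_eq_zero : ∀ s < k, ∀ i ∉ G s, b s i = 0
  abs_b_le : ∀ s < k, ∀ i, |b s i| ≤ 1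
  exists_b_eq : ∀ s < k, ∃ i ∈ G s, b s i = -1
  u_eq_zero : ∀ s ≤ k, ∀ j ∉ S, u s j = 0
  abs_u_le : ∀ s ≤ k, ∀ j, |u s j| ≤ 1
  exists_u_eq : ∀ s ≤ k, ∃ j ∈ S, u s j = -1
  sum_u : ∀ s ≤ k, ∑ j, u s j = 0
  u_orthogonal : ∀ t ≤ k, ∀ s < t, u s ⬝ᵥ u t = 0
  query_orthogonal : ∀ s ≤ k, ∀ t < s, u s ⬝ᵥ (q t).2 = 0

-- The algorithm enters only through `hq`: query `t` is determined by the responses to the earlier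
-- ones. This lets the final output be passed off as a query.
open Finset in
lemma exists_isResisting {n d T : ℕ} (σ K : ℝ) (G : ℕ → Finset (Fin n)) (S : Finset (Fin d))
    (hG : ∀ k ≤ T, T < #(G k)) (hS : 2 * T + 3 < #S)
    (q : Matrix (Fin n) (Fin d) ℝ → ℕ → (Fin n → ℝ) × (Fin d → ℝ))
    (hq : ∀ A A' t, (∀ s < t, twoSidedOracle A' (q A s) = twoSidedOracle A (q A s)) →
      q A' t = q A t) (k : ℕ) (hk : k ≤ T + 1) :
    ∃ b u, IsResisting G S k b u (q (telescopingMatrix σ K b u k)) := by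
  induction k with
  | zero =>
    obtain ⟨v, h1, h2, h3, h4⟩ := exists_normalized_orthogonal
      (fun _ : Unit => (1 : Fin d → ℝ)) S (by simp; omega)
    refine ⟨fun _ => 0, fun _ => v, by simp, by simp, by simp, fun _ _ => h1, fun _ _ => h3,
      fun _ _ => h4, fun _ _ => ?_, ?_, ?_⟩
    · simpa [one_dotProduct] using h2 ()
    · intro t ht s hs; omega
    · intro t ht s hs; omega
  | succ k ih =>
    obtain ⟨b, u, H⟩ := ih (by omega)
    set A := telescopingMatrix σ K b u k with hA
    obtain ⟨x, x1, x2, x3, x4⟩ := exists_normalized_orthogonal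
      (fun t : Fin k => (q A t).1) (G k) (by have := hG k (by omega); simp; omega)
    -- There are `1 + 2(k + 1) ≤ 2T + 3` constraints, whence the size of `S`.
    obtain ⟨v, v1, v2, v3, v4⟩ := exists_normalized_orthogonal
      (Sum.elim (fun _ : Unit => (1 : Fin d → ℝ))
        (Sum.elim (fun t : Fin (k + 1) => (q A t).2) (fun t : Fin (k + 1) => u t))) S
      (by simp; omega)
    have v5 : ∑ j, v j = 0 := by simpa [one_dotProduct] using v2 (Sum.inl ())
    have v6 : ∀ t ≤ k, (q A t).2 ⬝ᵥ v = 0 := fun t ht =>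
      v2 (Sum.inr (Sum.inl ⟨t, by omega⟩))
    have v7 : ∀ t ≤ k, u t ⬝ᵥ v = 0 := fun t ht =>
      v2 (Sum.inr (Sum.inr ⟨t, by omega⟩))
    set b' := Function.update b k x with hb'
    set u' := Function.update u (k + 1) v with hu'
    have hbs : ∀ s < k, b' s = b s := fun s hs => by
      rw [hb', Function.update_of_ne (by omega)]
    have hbk : b' k = x := by simp [hb']
    have hus : ∀ s ≤ k, u' s = u s := fun s hs => by
      rw [hu', Function.update_of_ne (by omega)]
    have huk : u' (k + 1) = v := by simp [hu']
    set A' := telescopingMatrix σ K b' u' (k + 1) with hA'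
    have hAA : A' = A + vecMulVec ((σ * K) • x) (u k - v) := by
      rw [hA', telescopingMatrix_succ, telescopingMatrix_congr σ K hbs hus, hbk, huk,
        hus k le_rfl]
    -- The response to query `k` itself may change; this is harmless, since that query depends only
    -- on responses before it.
    have hO : ∀ s < k, twoSidedOracle A' (q A s) = twoSidedOracle A (q A s) := by
      intro s hs
      rw [hAA]
      apply twoSidedOracle_add_vecMulVec
      · rw [dotProduct_smul, x2 ⟨s, hs⟩, smul_zero]
      · rw [sub_dotProduct, H.query_orthogonal k le_rfl s hs, dotProduct_comm v,
          v6 s hs.le, sub_zero]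
    have hqq : ∀ t ≤ k, q A' t = q A t := fun t ht =>
      hq _ _ _ fun s hs => hO s (by omega)
    refine ⟨b', u', ?_, ?_, ?_, ?_, ?_, ?_, ?_, ?_, ?_⟩
    · intro s hs
      rcases Nat.lt_succ_iff_lt_or_eq.1 hs with h | rfl
      · rw [hbs s h]; exact H.b_eq_zero s h
      · rw [hbk]; exact x1
    · intro s hs
      rcases Nat.lt_succ_iff_lt_or_eq.1 hs with h | rfl
      · rw [hbs s h]; exact H.abs_b_le s h
      · rw [hbk]; exact x3
    · intro s hs
      rcases Nat.lt_succ_iff_lt_or_eq.1 hs with h | rfl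
      · rw [hbs s h]; exact H.exists_b_eq s h
      · rw [hbk]; exact x4
    · intro s hs
      rcases Nat.le_succ_iff.1 hs with h | rfl
      · rw [hus s h]; exact H.u_eq_zero s h
      · rw [huk]; exact v1
    · intro s hs
      rcases Nat.le_succ_iff.1 hs with h | rfl
      · rw [hus s h]; exact H.abs_u_le s h
      · rw [huk]; exact v3
    · intro s hs
      rcases Nat.le_succ_iff.1 hs with h | rfl
      · rw [hus s h]; exact H.exists_u_eq s h
      · rw [huk]; exact v4
    · intro s hs
      rcases Nat.le_succ_iff.1 hs with h | rfl
      · rw [hus s h]; exact H.sum_u s h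
      · rw [huk]; exact v5
    · intro t ht s hst
      rcases Nat.le_succ_iff.1 ht with h | rfl
      · rw [hus t h, hus s (by omega)]; exact H.u_orthogonal t h s hst
      · rw [huk, hus s (by omega)]; exact v7 s (by omega)
    · intro s hs t hts
      rw [hqq t (by omega)]
      rcases Nat.le_succ_iff.1 hs with h | rfl
      · rw [hus s h]; exact H.query_orthogonal s h t hts
      · rw [huk, dotProduct_comm]; exact v6 t (by omega)

/-! ### A good mixed strategy -/

open Finset in
/-- Bounded vectors with zero sum, supported on `S`, pairwise orthogonal and of norm at least `1`
have the same, large, inner product with some mixed strategy. -/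
lemma exists_mem_stdSimplex_dotProduct_eq {d m : ℕ} (S : Finset (Fin d)) (hS : S.Nonempty)
    (hm : 0 < m) (u : ℕ → Fin d → ℝ) (hu0 : ∀ s < m, ∀ j ∉ S, u s j = 0)
    (hu1 : ∀ s < m, 1 ≤ u s ⬝ᵥ u s) (hsum : ∀ s < m, ∑ j, u s j = 0)
    (horth : ∀ s < m, ∀ t < m, s ≠ t → u s ⬝ᵥ u t = 0) :
    ∃ w ∈ stdSimplex ℝ (Fin d), ∀ s < m, u s ⬝ᵥ w = 1 / (#S * √m) := by
  have hSpos : (0 : ℝ) < #S := by exact_mod_cast hS.card_pos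
  have hmpos : (0 : ℝ) < √m := Real.sqrt_pos.2 (by exact_mod_cast hm)
  set β : ℝ := 1 / (#S * √m) with hβ
  have hβpos : 0 < β := by positivity
  set y : Fin d → ℝ := ∑ s ∈ range m, (u s ⬝ᵥ u s)⁻¹ • u s with hy
  have hyu : ∀ s < m, u s ⬝ᵥ y = 1 := by
    intro s hs
    rw [hy, dotProduct_sum, sum_eq_single_of_mem s (mem_range.2 hs)]
    · have := hu1 s hs
      rw [dotProduct_smul, smul_eq_mul, inv_mul_cancel₀ (by linarith)]
    · intro t ht hts
      rw [dotProduct_smul, horth s hs t (mem_range.1 ht) hts.symm, smul_zero]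
  have hyy : y ⬝ᵥ y ≤ m := by
    nth_rewrite 1 [hy]
    rw [sum_dotProduct]
    calc _ ≤ ∑ s ∈ range m, (1 : ℝ) := by
          refine sum_le_sum fun s hs => ?_
          rw [smul_dotProduct, hyu s (mem_range.1 hs), smul_eq_mul, mul_one]
          exact inv_le_one_of_one_le₀ (hu1 s (mem_range.1 hs))
      _ = m := by simp
  have hyj : ∀ j, |y j| ≤ √m := by
    intro j
    apply Real.abs_le_sqrt
    refine le_trans ?_ hyy
    rw [sq]
    exact single_le_sum (f := fun j => y j * y j) (fun i _ => mul_self_nonneg _) (mem_univ j)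
  have hy0 : ∀ j ∉ S, y j = 0 := by
    intro j hj
    rw [hy, Finset.sum_apply]
    refine sum_eq_zero fun s hs => ?_
    simp [hu0 s (mem_range.1 hs) j hj]
  have hysum : ∑ j, y j = 0 := by
    simp only [hy, Finset.sum_apply, Pi.smul_apply, smul_eq_mul]
    rw [sum_comm]
    refine sum_eq_zero fun s hs => ?_
    rw [← mul_sum, hsum s (mem_range.1 hs), mul_zero]
  -- The uniform strategy on `S` is orthogonal to each `u s`. Adding `β * y` keeps the total mass,
  -- as `y` has zero sum, and keeps the entries nonnegative, as `β * √m = 1 / #S`.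
  refine ⟨fun j => (if j ∈ S then (#S : ℝ)⁻¹ else 0) + β * y j, ⟨fun j => ?_, ?_⟩, fun s hs => ?_⟩
  · by_cases hj : j ∈ S
    · have h1 : β * √m = (#S : ℝ)⁻¹ := by rw [hβ]; field_simp
      have h2 := mul_le_mul_of_nonneg_left (neg_le_of_abs_le (hyj j)) hβpos.le
      simp only [hj, if_true]
      linarith
    · simp [hj, hy0 j hj]
  · rw [sum_add_distrib, ← mul_sum, hysum, mul_zero, add_zero, sum_ite_mem, univ_inter,
      sum_const, nsmul_eq_mul, mul_inv_cancel₀ hSpos.ne']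
  · have h1 : u s ⬝ᵥ (fun j => (if j ∈ S then (#S : ℝ)⁻¹ else 0)) = 0 := by
      have : ∀ j, u s j * (if j ∈ S then (#S : ℝ)⁻¹ else 0) = u s j * (#S : ℝ)⁻¹ := by
        intro j
        by_cases hj : j ∈ S
        · simp [hj]
        · simp [hj, hu0 s hs j hj]
      simp only [dotProduct, this]
      rw [← sum_mul, hsum s hs, zero_mul]
    have h2 : (fun j => (if j ∈ S then (#S : ℝ)⁻¹ else 0) + β * y j) =
      (fun j => (if j ∈ S then (#S : ℝ)⁻¹ else 0)) + β • y := rfl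
    rw [h2, dotProduct_add, h1, dotProduct_smul, hyu s hs, smul_eq_mul, mul_one, zero_add]

/-! ### The hard matrix -/

open Finset in
/-- The hard matrix for a deterministic algorithm: some mixed strategy has value
`1 / ((2T+3) (2T+4) √(T+2))` against every row, while the output has nonpositive value against
some row. -/
theorem exists_hard_matrix {T n d : ℕ} (hn : (T + 1) * (T + 1) ≤ n) (hd : 2 * T + 4 ≤ d)
    {Out : Type} (alg : TwoSidedAlgorithm n d Out) (out : Out → Fin d → ℝ) :
    ∃ A : Matrix (Fin n) (Fin d) ℝ, (∀ i j, A i j ∈ Set.Icc (-1 : ℝ) 1) ∧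
      (∃ w ∈ stdSimplex ℝ (Fin d), ∀ i,
        (A *ᵥ w) i = 1 / ((2 * T + 3) * (2 * T + 4) * √(T + 2))) ∧
      ∃ i, (A *ᵥ out (alg.run A T)) i ≤ 0 := by
  -- Blocks of `T + 1` rows, enough for at most `T` constraints on each `b s`. Rows past the first
  -- `T + 1` blocks stay unperturbed.
  set G : ℕ → Finset (Fin n) := fun k => univ.filter fun i => i.val / (T + 1) = k with hGdef
  have hG : ∀ k ≤ T, T < #(G k) := by
    intro k hk
    have hlt : ∀ r : Fin (T + 1), k * (T + 1) + r.val < n := fun r => by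
      have h1 := r.isLt
      have h2 : k * (T + 1) ≤ T * (T + 1) := Nat.mul_le_mul_right _ hk
      nlinarith
    have hsub : univ.image (fun r : Fin (T + 1) => (⟨k * (T + 1) + r.val, hlt r⟩ : Fin n)) ⊆ G k := by
      intro i hi
      obtain ⟨r, -, rfl⟩ := mem_image.1 hi
      simp only [hGdef, mem_filter, mem_univ, true_and]
      rw [mul_comm, Nat.mul_add_div (by omega), Nat.div_eq_of_lt r.isLt, add_zero]
    have hcard := card_le_card hsub
    rw [card_image_of_injective _ (by
      intro r r' h
      simp only [Fin.mk.injEq] at h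
      exact Fin.ext (by omega)), card_univ, Fintype.card_fin] at hcard
    omega
  obtain ⟨S, hScard⟩ : ∃ S : Finset (Fin d), #S = 2 * T + 4 := by
    obtain ⟨S, -, hS⟩ := exists_subset_card_eq (s := (univ : Finset (Fin d))) (n := 2 * T + 4)
      (by simpa using hd)
    exact ⟨S, hS⟩
  -- From round `T` on, the output plays the role of the query.
  set q : Matrix (Fin n) (Fin d) ℝ → ℕ → (Fin n → ℝ) × (Fin d → ℝ) := fun A t =>
    if t < T then alg.query (alg.transcript A t) else (0, out (alg.run A T)) with hqdef
  have hq : ∀ A A' t, (∀ s < t, twoSidedOracle A' (q A s) = twoSidedOracle A (q A s)) →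
      q A' t = q A t := by
    intro A A' t h
    have key : ∀ r ≤ t, r ≤ T → alg.transcript A' r = alg.transcript A r := by
      intro r hrt hrT
      refine alg.transcript_congr A A' r fun s hs => ?_
      have := h s (by omega)
      simpa only [hqdef, if_pos (show s < T by omega)] using this
    by_cases ht : t < T
    · simp only [hqdef, if_pos ht, key t le_rfl ht.le]
    · simp only [hqdef, if_neg ht, TwoSidedAlgorithm.run, key T (by omega) le_rfl]
  -- Each row meets at most one correction, so an unscaled entry is at most `1 + 2(T + 1)` in
  -- modulus.
  set σ : ℝ := 1 / (2 * T + 3) with hσ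
  have hσpos : 0 < σ := by positivity
  obtain ⟨b, u, H⟩ := exists_isResisting σ ((T : ℝ) + 1) G S hG (by omega) q hq (T + 1) le_rfl
  set A := telescopingMatrix σ ((T : ℝ) + 1) b u (T + 1) with hA
  have hother : ∀ i, ∀ s < T + 1, s ≠ i.val / (T + 1) → b s i = 0 := by
    intro i s hs hne
    refine H.b_eq_zero s hs i fun hi => hne ?_
    simpa [hGdef, eq_comm] using hi
  refine ⟨A, fun i j => ?_, ?_, ?_⟩
  · rw [hA, telescopingMatrix_apply, Set.mem_Icc, ← abs_le, abs_mul, abs_of_pos hσpos]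
    have hsum : |∑ s ∈ range (T + 1), b s i * (u s j - u (s + 1) j)| ≤ 2 := by
      by_cases hi : i.val / (T + 1) < T + 1
      · rw [sum_eq_single_of_mem _ (mem_range.2 hi)
          fun s hs hne => by rw [hother i s (mem_range.1 hs) hne, zero_mul], abs_mul]
        have h1 := H.abs_b_le _ hi i
        have h2 : |u (i.val / (T + 1)) j - u (i.val / (T + 1) + 1) j| ≤ 2 := by
          have h3 := H.abs_u_le (i.val / (T + 1)) hi.le j
          have h4 := H.abs_u_le (i.val / (T + 1) + 1) hi j
          have := abs_sub (u (i.val / (T + 1)) j) (u (i.val / (T + 1) + 1) j)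
          linarith
        nlinarith [abs_nonneg (b (i.val / (T + 1)) i)]
      · rw [sum_eq_zero]
        · simp
        · intro s hs
          have := mem_range.1 hs
          rw [hother i s this (by omega), zero_mul]
    have h0 := H.abs_u_le 0 (by omega) j
    have h5 : |u 0 j + ((T : ℝ) + 1) * ∑ s ∈ range (T + 1), b s i * (u s j - u (s + 1) j)| ≤
        2 * T + 3 := by
      refine (abs_add_le _ _).trans ?_
      rw [abs_mul, abs_of_pos (by positivity : (0 : ℝ) < (T : ℝ) + 1)]
      nlinarith [(Nat.cast_nonneg T : (0 : ℝ) ≤ T)]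
    rw [hσ, one_div, inv_mul_le_iff₀ (by positivity), mul_one]
    exact h5
  · obtain ⟨w, hw, hwu⟩ := exists_mem_stdSimplex_dotProduct_eq (m := T + 2) S
      (card_pos.1 (by omega)) (by omega) u (fun s hs => H.u_eq_zero s (by omega))
      (fun s hs => by
        obtain ⟨j, -, hj⟩ := H.exists_u_eq s (by omega)
        have := single_le_sum (f := fun j => u s j * u s j) (fun i _ => mul_self_nonneg _)
          (mem_univ j)
        simp only [hj] at this
        rw [dotProduct]
        linarith)
      (fun s hs => H.sum_u s (by omega))
      (fun s hs t ht hne => by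
        rcases lt_or_gt_of_ne hne with h | h
        · exact H.u_orthogonal t (by omega) s h
        · rw [dotProduct_comm]; exact H.u_orthogonal s (by omega) t h)
    refine ⟨w, hw, fun i => ?_⟩
    rw [hA, telescopingMatrix_mulVec, sum_eq_zero, mul_zero, add_zero, hwu 0 (by omega), hσ,
      hScard]
    · push_cast
      rw [div_mul_div_comm, one_mul, mul_assoc]
    · intro s hs
      have := mem_range.1 hs
      rw [hwu s (by omega), hwu (s + 1) (by omega), sub_self, mul_zero]
  · set w := out (alg.run A T) with hw
    have hlast : u (T + 1) ⬝ᵥ w = 0 := by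
      have := H.query_orthogonal (T + 1) le_rfl T (by omega)
      simpa only [hqdef, lt_irrefl, if_false] using this
    have htel : ∑ s ∈ range (T + 1), (u s ⬝ᵥ w - u (s + 1) ⬝ᵥ w) = u 0 ⬝ᵥ w := by
      rw [sum_range_sub' (fun s => u s ⬝ᵥ w), hlast, sub_zero]
    -- The factor `K = T + 1` makes an average increment enough to cancel `u 0 ⬝ᵥ w`.
    obtain ⟨s, hs, hle⟩ : ∃ s ∈ range (T + 1),
        u 0 ⬝ᵥ w / (T + 1) ≤ u s ⬝ᵥ w - u (s + 1) ⬝ᵥ w := by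
      apply exists_le_of_sum_le (by simp)
      rw [htel, sum_const, card_range, nsmul_eq_mul]
      push_cast
      rw [mul_div_cancel₀ _ (by positivity)]
    have hs' := mem_range.1 hs
    obtain ⟨i, hi, hbi⟩ := H.exists_b_eq s hs'
    have hgi : s = i.val / (T + 1) := by simpa [hGdef, eq_comm] using hi
    refine ⟨i, ?_⟩
    rw [hA, telescopingMatrix_mulVec, sum_eq_single_of_mem s hs
      fun t ht hne => by rw [hother i t (mem_range.1 ht) (hgi ▸ hne), zero_mul], hbi]
    rw [div_le_iff₀ (by positivity)] at hle
    apply mul_nonpos_of_nonneg_of_nonpos hσpos.le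
    linarith

/-! ### Game values -/

/-- The value of `w` against the simplex is the smallest coordinate of `A w`. -/
lemma isMinValue_inf' {n d : ℕ} (A : Matrix (Fin n) (Fin d) ℝ) (w : Fin d → ℝ)
    (h : (Finset.univ : Finset (Fin n)).Nonempty) :
    IsMinValue A w (Finset.univ.inf' h (A *ᵥ w)) := by
  constructor
  · obtain ⟨i, -, hi⟩ := Finset.exists_mem_eq_inf' h (A *ᵥ w)
    exact ⟨Pi.single i 1, single_mem_stdSimplex ℝ i, by simp [hi]⟩
  · rintro _ ⟨p, hp, rfl⟩
    calc _ = ∑ i, p i * Finset.univ.inf' h (A *ᵥ w) := by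
          rw [← Finset.sum_mul, hp.2, one_mul]
      _ ≤ _ := Finset.sum_le_sum fun i hi =>
          mul_le_mul_of_nonneg_left (Finset.inf'_le _ hi) (hp.1 i)

lemma IsMinValue.le_mulVec {n d : ℕ} {A : Matrix (Fin n) (Fin d) ℝ} {w : Fin d → ℝ} {v : ℝ}
    (h : IsMinValue A w v) (i : Fin n) : v ≤ (A *ᵥ w) i :=
  h.2 ⟨Pi.single i 1, single_mem_stdSimplex ℝ i, by simp⟩

/-- The game value over a compact set exists, and dominates the value of every member. -/
lemma exists_isGameValue {n d : ℕ} (hn : 0 < n) {W : Set (Fin d → ℝ)} (hW : IsCompact W)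
    (A : Matrix (Fin n) (Fin d) ℝ) {w : Fin d → ℝ} (hw : w ∈ W) {g : ℝ}
    (hg : ∀ i, g ≤ (A *ᵥ w) i) : ∃ γ, IsGameValue W A γ ∧ g ≤ γ := by
  have h : (Finset.univ : Finset (Fin n)).Nonempty := ⟨⟨0, hn⟩, Finset.mem_univ _⟩
  have hcont : Continuous fun w : Fin d → ℝ => Finset.univ.inf' h (A *ᵥ w) := by
    refine Continuous.finset_inf'_apply h fun i _ => ?_
    exact (continuous_apply i).comp (Continuous.matrix_mulVec continuous_const continuous_id)
  obtain ⟨w₀, hw₀, hmax⟩ := hW.exists_isMaxOn ⟨w, hw⟩ hcont.continuousOn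
  refine ⟨_, ⟨⟨w₀, hw₀, isMinValue_inf' A w₀ h⟩, ?_⟩, ?_⟩
  · rintro v ⟨w₁, hw₁, hv⟩
    rw [hv.unique (isMinValue_inf' A w₁ h)]
    exact hmax hw₁
  · exact (Finset.le_inf' h _ fun i _ => hg i).trans (hmax hw)

lemma isCompact_l1Ball (d : ℕ) : IsCompact (l1Ball d) := by
  refine (isCompact_closedBall (0 : Fin d → ℝ) 1).of_isClosed_subset ?_ ?_
  · exact isClosed_le (by fun_prop) continuous_const
  · intro w hw
    rw [mem_closedBall_zero_iff, pi_norm_le_iff_of_nonneg zero_le_one]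
    intro i
    exact (Finset.single_le_sum (f := fun i => |w i|) (fun i _ => abs_nonneg _)
      (Finset.mem_univ i)).trans hw

lemma stdSimplex_subset_l1Ball (d : ℕ) : stdSimplex ℝ (Fin d) ⊆ l1Ball d := by
  intro w hw
  have : ∑ i, |w i| = ∑ i, w i := Finset.sum_congr rfl fun i _ => abs_of_nonneg (hw.1 i)
  exact (this.trans hw.2).le

/-! ### Numerical bounds and conclusion -/

lemma one_div_sq_mul_sqrt_le {T : ℝ} (hT : 1 ≤ T) :
    1 / 60 * (1 / (T ^ 2 * √T)) ≤ 1 / ((2 * T + 3) * (2 * T + 4) * √(T + 2)) := by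
  have h1 : √(T + 2) ≤ 2 * √T := by
    rw [Real.sqrt_le_left (by positivity), mul_pow, Real.sq_sqrt (by linarith)]
    linarith
  have hpos : 0 < √T := Real.sqrt_pos.2 (by linarith)
  rw [div_mul_div_comm, one_mul]
  apply one_div_le_one_div_of_le (by positivity)
  calc (2 * T + 3) * (2 * T + 4) * √(T + 2) ≤ (5 * T * (6 * T)) * (2 * √T) := by
        gcongr <;> linarith
    _ = 60 * (T ^ 2 * √T) := by ring

lemma one_le_log {x : ℝ} (hx : 3 ≤ x) : 1 ≤ Real.log x := by
  rw [Real.le_log_iff_exp_le (by linarith)]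
  linarith [Real.exp_one_lt_d9]

/-- The powers of `a` and `b` are at most `1` and drop out; the fifth power of the rest gives `(100
T)⁵ ≤ 1 / ε²`, and `3600 < 100⁵`. -/
lemma lt_of_le_rpow_mul {T ε a b : ℝ} (hT : 1 ≤ T) (hε : 0 < ε) (ha : 1 ≤ a) (hb : 1 ≤ b)
    (h : T ≤ 1 / 100 * a ^ (-(2 / 5) : ℝ) * b ^ (-(1 / 5) : ℝ) * ε ^ (-(2 / 5) : ℝ)) :
    ε < 1 / 60 * (1 / (T ^ 2 * √T)) := by
  have ha' : a ^ (-(2 / 5) : ℝ) ≤ 1 := Real.rpow_le_one_of_one_le_of_nonpos ha (by norm_num)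
  have hb' : b ^ (-(1 / 5) : ℝ) ≤ 1 := Real.rpow_le_one_of_one_le_of_nonpos hb (by norm_num)
  have ha0 : 0 ≤ a ^ (-(2 / 5) : ℝ) := Real.rpow_nonneg (by linarith) _
  have hb0 : 0 ≤ b ^ (-(1 / 5) : ℝ) := Real.rpow_nonneg (by linarith) _
  have he0 : 0 < ε ^ (-(2 / 5) : ℝ) := Real.rpow_pos_of_pos hε _
  have h1 : 100 * T ≤ ε ^ (-(2 / 5) : ℝ) := by
    have h2 : a ^ (-(2 / 5) : ℝ) * b ^ (-(1 / 5) : ℝ) ≤ 1 := mul_le_one₀ ha' hb0 hb'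
    nlinarith
  have hsq : (ε ^ (-(2 / 5) : ℝ)) ^ 5 = 1 / ε ^ 2 := by
    rw [← Real.rpow_natCast, ← Real.rpow_mul hε.le, one_div, ← Real.rpow_natCast,
      ← Real.rpow_neg hε.le]
    norm_num
  have h5 : (100 * T) ^ 5 ≤ 1 / ε ^ 2 := by
    rw [← hsq]
    gcongr
  have hs : 0 < √T := Real.sqrt_pos.2 (by linarith)
  have hX : (T ^ 2 * √T) ^ 2 = T ^ 5 := by
    rw [mul_pow, Real.sq_sqrt (by linarith)]
    ring
  rw [div_mul_div_comm, one_mul, lt_div_iff₀ (by positivity)]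
  rw [le_div_iff₀ (by positivity)] at h5
  have h6 : (ε * (60 * (T ^ 2 * √T))) ^ 2 < 1 ^ 2 := by
    have : 0 < T ^ 5 * ε ^ 2 := by positivity
    calc (ε * (60 * (T ^ 2 * √T))) ^ 2 = 3600 * ((T ^ 2 * √T) ^ 2 * ε ^ 2) := by ring
      _ = 3600 * (T ^ 5 * ε ^ 2) := by rw [hX]
      _ < 100 ^ 5 * (T ^ 5 * ε ^ 2) := by gcongr; norm_num
      _ = (100 * T) ^ 5 * ε ^ 2 := by ring
      _ ≤ 1 ^ 2 := by linarith
  exact lt_of_pow_lt_pow_left₀ 2 zero_le_one h6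

theorem theorem3 :
    (∃ c : ℝ, 0 < c ∧
      ∀ T n d : ℕ, c < (T : ℝ) → c * (T : ℝ) < (d : ℝ) →
        c * (T : ℝ) ^ 2 * Real.log (T : ℝ) < (n : ℝ) →
        ∀ alg : TwoSidedAlgorithm n d (Fin d → ℝ),
          ∃ A : Matrix (Fin n) (Fin d) ℝ,
            (∀ i j, A i j ∈ Set.Icc (-1 : ℝ) 1) ∧
            (∃ γ : ℝ, IsGameValue (l1Ball d) A γ ∧
              1 / (c * Real.log (d : ℝ) * √(Real.log (n : ℝ))) *
                (1 / ((T : ℝ) ^ 2 * √(T : ℝ))) ≤ γ) ∧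
            (∃ v : ℝ, IsMinValue A (alg.run A T) v ∧ v ≤ 0)) ∧
    (∃ C : ℝ, 0 < C ∧
      ∀ (T n d : ℕ) (ε : ℝ), 1 ≤ T → 0 < ε → C * (T : ℝ) < (d : ℝ) →
        C * (T : ℝ) ^ 2 * Real.log ((T : ℝ) + 1) < (n : ℝ) →
        (T : ℝ) ≤ 1 / C * Real.log (d : ℝ) ^ (-(2 / 5) : ℝ) *
          Real.log (n : ℝ) ^ (-(1 / 5) : ℝ) * ε ^ (-(2 / 5) : ℝ) →
        (∀ alg : TwoSidedAlgorithm n d (Fin d → ℝ),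
          ∃ A : Matrix (Fin n) (Fin d) ℝ, (∀ i j, A i j ∈ Set.Icc (-1 : ℝ) 1) ∧
            ¬ IsSuboptimalStrategy (stdSimplex ℝ (Fin d)) A ε (alg.run A T)) ∧
        (∀ alg : TwoSidedAlgorithm n d ((Fin n → ℝ) × (Fin d → ℝ)),
          ∃ A : Matrix (Fin n) (Fin d) ℝ, (∀ i j, A i j ∈ Set.Icc (-1 : ℝ) 1) ∧
            ¬ IsApproxNash A ε (alg.run A T))) := by
  constructor
  · refine ⟨60, by norm_num, fun T n d hT hd hn alg => ?_⟩
    have hTpos : (1 : ℝ) ≤ T := by linarith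
    have hlogT : 1 ≤ Real.log (T : ℝ) := one_le_log (by linarith)
    have hn' : 60 * (T : ℝ) ^ 2 < n := by nlinarith [sq_nonneg (T : ℝ)]
    have hn1 : (T + 1) * (T + 1) ≤ n := by
      have : ((T : ℝ) + 1) * (T + 1) ≤ n := by nlinarith
      exact_mod_cast this
    have hd1 : 2 * T + 4 ≤ d := by
      have : 2 * (T : ℝ) + 4 ≤ d := by linarith
      exact_mod_cast this
    have hn0 : 0 < n := lt_of_lt_of_le (by positivity) hn1
    obtain ⟨A, hA, ⟨w, hw, hwv⟩, i, hi⟩ := exists_hard_matrix hn1 hd1 alg id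
    obtain ⟨γ, hγ, hle⟩ := exists_isGameValue hn0 (isCompact_l1Ball d) A
      (stdSimplex_subset_l1Ball d hw) (fun i => (hwv i).ge)
    have hmin := isMinValue_inf' A (alg.run A T) ⟨⟨0, hn0⟩, Finset.mem_univ _⟩
    refine ⟨A, hA, ⟨γ, hγ, le_trans ?_ hle⟩, _, hmin, (hmin.le_mulVec i).trans hi⟩
    refine le_trans ?_ (one_div_sq_mul_sqrt_le hTpos)
    have hlogd : 1 ≤ Real.log (d : ℝ) := one_le_log (by linarith)
    have hlogn : 1 ≤ √(Real.log (n : ℝ)) := Real.one_le_sqrt.2 (one_le_log (by nlinarith))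
    have : (60 : ℝ) ≤ 60 * Real.log (d : ℝ) * √(Real.log (n : ℝ)) := by nlinarith
    gcongr
  · refine ⟨100, by norm_num, fun T n d ε hT hε hd hn hTε => ?_⟩
    have hTpos : (1 : ℝ) ≤ T := by exact_mod_cast hT
    have hlogT : 1 / 2 ≤ Real.log ((T : ℝ) + 1) := by
      have h1 : Real.log 2 ≤ Real.log ((T : ℝ) + 1) :=
        Real.log_le_log (by norm_num) (by linarith)
      linarith [Real.log_two_gt_d9]
    have hn' : 50 * (T : ℝ) ^ 2 < n := by nlinarith [sq_nonneg (T : ℝ)]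
    have hn1 : (T + 1) * (T + 1) ≤ n := by
      have : ((T : ℝ) + 1) * (T + 1) ≤ n := by nlinarith
      exact_mod_cast this
    have hd1 : 2 * T + 4 ≤ d := by
      have : 2 * (T : ℝ) + 4 ≤ d := by linarith
      exact_mod_cast this
    have hn0 : 0 < n := lt_of_lt_of_le (by positivity) hn1
    have hlt := (lt_of_le_rpow_mul hTpos hε (one_le_log (by linarith)) (one_le_log (by nlinarith))
      hTε).trans_le (one_div_sq_mul_sqrt_le hTpos)
    refine ⟨fun alg => ?_, fun alg => ?_⟩
    · obtain ⟨A, hA, ⟨w, hw, hwv⟩, i, hi⟩ := exists_hard_matrix hn1 hd1 alg id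
      refine ⟨A, hA, fun hsub => ?_⟩
      obtain ⟨γ, hγ, hle⟩ := exists_isGameValue hn0 (isCompact_stdSimplex ℝ (Fin d)) A hw
        (fun i => (hwv i).ge)
      have hmin := isMinValue_inf' A (alg.run A T) ⟨⟨0, hn0⟩, Finset.mem_univ _⟩
      have h1 := hsub.2 γ _ hγ hmin
      have h2 := (hmin.le_mulVec i).trans hi
      linarith
    · obtain ⟨A, hA, ⟨w, hw, hwv⟩, i, hi⟩ := exists_hard_matrix hn1 hd1 alg Prod.snd
      refine ⟨A, hA, fun hnash => ?_⟩
      have h1 := hnash.2.2 (Pi.single i 1) (single_mem_stdSimplex ℝ i) w hw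
      -- All rows pay `w` equally, so the returned row strategy is irrelevant.
      have h2 : (alg.run A T).1 ⬝ᵥ (A *ᵥ w) = 1 / ((2 * T + 3) * (2 * T + 4) * √(T + 2)) := by
        rw [dotProduct]
        simp only [hwv]
        rw [← Finset.sum_mul, hnash.1.2, one_mul]
      rw [h2, single_dotProduct, one_mul] at h1
      linarith
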